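/- Let $k$ be a commutative ring, $G$ a group, and $\otimes=\otimes_k$. Algebras are associative, but need not have a unit element. A $k$-algebra $A$ (resp. a left $A$-module $M$) is called *unital* if the canonical map $A\otimes_A A\to A$ (resp. $A\otimes_A M\to M$) is an isomorphism. Put $A^{\rm e}=A\otimes A^{\rm op}$, acting on $A$ by $(a\otimes b)\cdot x=axb$. A *Taylor–Azumaya algebra* is a unital $k$-algebra $A$, faithful as a $k$-module, such that the adjoint functors $F(N)=A\otimes N$ (from $k$-modules to unital left $A^{\rm e}$-modules) and $H_l(M)={\rm Hom}_{A^{\rm e}}(A,M)$ (in the other direction) are inverse equivalences, i.e. the unit and the counit of the adjunction are isomorphisms. It is a *$G$-module Taylor–Azumaya algebra* if moreover $G$ acts on $A$ by $k$-algebra automorphisms. The *multiplier algebra* $M(A)$ consists of the pairs $x=(\rho_1,\rho_2)$ of $k$-linear maps $A\to A$ with $\rho_1$ right $A$-linear, $\rho_2$ left $A$-linear and $a\rho_1(b)=\rho_2(a)b$ for all $a,b\in A$; one writes $xb=\rho_1(b)$ and $bx=\rho_2(b)$. Its product is $(\rho_1,\rho_2)(\rho_1',\rho_2')=(\rho_1\circ\rho_1',\rho_2'\circ\rho_2)$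 and its unit is $({\rm id},{\rm id})$. The $G$-action on $A$ is *strongly inner* if there is a group morphism $f:G\to U(M(A))$ into the group of units of $M(A)$ with $g\cdot a=f(g)\,a\,f(g^{-1})$ for all $g\in G$, $a\in A$. The smash product $A\# kG$ is $A\otimes kG$ (with $a\otimes g$ written $a\# g$) with multiplication $(a\# g)(b\# h)=a(g\cdot b)\# gh$; it is a left $A^{\rm e}$-module by $(a\otimes a')\cdot(b\# g)=ab(g\cdot a')\# g$. The $k$-module ${\rm Hom}_{A^{\rm e}}(A,A\# kG)$ is an algebra with product $(\varphi\psi)(\sum_i a_ia_i')=\sum_i\varphi(a_i)\psi(a_i')$ and unit $a\mapsto a\# 1$; its part of degree $g\in G$ consists of the maps with values in $A\# g$. The group algebra $kG$ is graded with $kg$ in degree $g$. **Lemma.** Let $A$ be a $G$-module Taylor–Azumaya algebra. The $G$-action on $A$ is strongly inner if and only if ${\rm Hom}_{A^{\rm e}}(A,A\# kG)\cong kG$ as $G$-graded $k$-algebras, that is, there is a $k$-algebra isomorphism $kG\to{\rm Hom}_{A^{\rm e}}(A,A\# kG)$ that maps $kg$ onto the part of degree $g$ for every $g\in G$. -/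

import Mathlib

open scoped TensorProduct

noncomputable section

namespace TaylorAzumaya

universe u v w

/-! ### Modules over algebras without unit

A left module over a (possibly non-unital) `k`-algebra `B` is a `k`-module `M` together with a
multiplicative `k`-linear map `ρ : B →ₙₐ[k] Module.End k M`; no unit is required to be preserved. -/

section Modules

variable {k : Type*} [CommRing k] {B : Type*} [NonUnitalRing B] [Module k B]
  {M : Type*} [AddCommGroup M] [Module k M] {N : Type*} [AddCommGroup N] [Module k N]

/-- The relations `(b * c) ⊗ m - b ⊗ (c • m)` that define `B ⊗_B M` as a quotient of `B ⊗_k M`. -/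
def balancedRel (ρ : B →ₙₐ[k] Module.End k M) : Submodule k (B ⊗[k] M) :=
  Submodule.span k {z | ∃ (b c : B) (m : M), z = (b * c) ⊗ₜ[k] m - b ⊗ₜ[k] ρ c m}

/-- The tensor product `B ⊗_B M`. -/
abbrev BalancedTensor (ρ : B →ₙₐ[k] Module.End k M) : Type _ :=
  (B ⊗[k] M) ⧸ balancedRel ρ

/-- The canonical map `B ⊗_B M → M`, `b ⊗ m ↦ b • m`. -/
def actionMap (ρ : B →ₙₐ[k] Module.End k M) : BalancedTensor ρ →ₗ[k] M :=
  (balancedRel ρ).liftQ (TensorProduct.lift (ρ : B →ₗ[k] Module.End k M)) (by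
    refine Submodule.span_le.2 ?_
    rintro _ ⟨b, c, m, rfl⟩
    simp)

/-- A left `B`-module `M` is unital if the canonical map `B ⊗_B M → M` is an isomorphism. -/
def IsUnitalModule (ρ : B →ₙₐ[k] Module.End k M) : Prop :=
  Function.Bijective (actionMap ρ)

/-- The `k`-module `Hom_B(M, N)` of `B`-linear maps. -/
def homSubmodule (ρ : B →ₙₐ[k] Module.End k M) (σ : B →ₙₐ[k] Module.End k N) :
    Submodule k (M →ₗ[k] N) where
  carrier := {f | ∀ (b : B) (m : M), f (ρ b m) = σ b (f m)}
  add_mem' := by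
    intro f g hf hg b m
    simp [hf b m, hg b m]
  zero_mem' := by
    intro b m
    simp
  smul_mem' := by
    intro r f hf b m
    simp [hf b m]

end Modules

section Algebras

variable (k : Type*) [CommRing k] (A : Type*) [NonUnitalRing A] [Module k A]
  [IsScalarTower k A A] [SMulCommClass k A A]

/-- A (not necessarily unit-possessing) `k`-algebra `A` is called unital if the canonical map
`A ⊗_A A → A` is an isomorphism. -/
class IsUnitalAlgebra : Prop where
  bijective : IsUnitalModule (NonUnitalAlgHom.lmul k A)

/-- The enveloping algebra `A ⊗ Aᵒᵖ`. -/
abbrev Env : Type _ := A ⊗[k] Aᵐᵒᵖ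

variable {A}

/-- Commuting left and right actions of `A` on `M`, that is, an `A`-bimodule structure on `M`,
regarded as a left module structure over the enveloping algebra: `(a ⊗ b) • m = (a • m) • b`. -/
def envAction {M : Type*} [AddCommGroup M] [Module k M]
    (l : A →ₙₐ[k] Module.End k M) (r : Aᵐᵒᵖ →ₙₐ[k] Module.End k M)
    (h : ∀ a b m, l a (r b m) = r b (l a m)) : Env k A →ₙₐ[k] Module.End k M where
  toFun := TensorProduct.lift (LinearMap.mk₂ k (fun a b => r b * l a)
    (by intros; simp [mul_add]) (by intros; simp)
    (by intros; simp [add_mul]) (by intros; simp))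
  map_smul' := by intros; simp
  map_zero' := by simp
  map_add' := by intros; simp
  map_mul' := by
    intro x y
    induction x using TensorProduct.induction_on with
    | zero => simp
    | add x x' hx hx' => rw [add_mul, map_add, hx, hx', map_add, add_mul]
    | tmul a b =>
      induction y using TensorProduct.induction_on with
      | zero => simp
      | add y y' hy hy' => rw [mul_add, map_add, hy, hy', map_add, mul_add]
      | tmul c d =>
        ext m
        simp [h]

theorem envAction_tmul {M : Type*} [AddCommGroup M] [Module k M]
    (l : A →ₙₐ[k] Module.End k M) (r : Aᵐᵒᵖ →ₙₐ[k] Module.End k M)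
    (h : ∀ a b m, l a (r b m) = r b (l a m)) (a : A) (b : Aᵐᵒᵖ) (m : M) :
    envAction k l r h (a ⊗ₜ b) m = r b (l a m) := rfl

variable (A)

/-- Right multiplication, as an action of `Aᵒᵖ` on `A`. -/
def rmul : Aᵐᵒᵖ →ₙₐ[k] Module.End k A where
  toFun b := LinearMap.mulRight k b.unop
  map_smul' := by intros; ext; simp [mul_smul_comm]
  map_zero' := by ext; simp
  map_add' := by intros; ext; simp [mul_add]
  map_mul' := by intros; ext; simp [mul_assoc]

/-- `A` as a left module over its enveloping algebra: `(a ⊗ b) • x = a * x * b`. -/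
def regAction : Env k A →ₙₐ[k] Module.End k A :=
  envAction k (NonUnitalAlgHom.lmul k A) (rmul k A) (by intros; simp [rmul, mul_assoc])

theorem regAction_tmul (a x : A) (b : Aᵐᵒᵖ) :
    regAction k A (a ⊗ₜ b) x = a * x * b.unop := rfl

/-- The functor `F` on objects: the enveloping algebra acts on `A ⊗ N` through the factor `A`. -/
def indAction (N : Type*) [AddCommGroup N] [Module k N] :
    Env k A →ₙₐ[k] Module.End k (A ⊗[k] N) :=
  (Module.End.rTensorAlgHom k A N : Module.End k A →ₙₐ[k] Module.End k (A ⊗[k] N)).comp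
    (regAction k A)

theorem indAction_apply (N : Type*) [AddCommGroup N] [Module k N] (z : Env k A) (x : A) (n : N) :
    indAction k A N z (x ⊗ₜ n) = (regAction k A z x) ⊗ₜ n := rfl

/-- The unit `N → Hom_{Aᵉ}(A, A ⊗ N)`, `n ↦ (a ↦ a ⊗ n)`, of the adjunction between
`F = A ⊗ -` and `H = Hom_{Aᵉ}(A, -)`. -/
def unitMap (N : Type*) [AddCommGroup N] [Module k N] :
    N →ₗ[k] homSubmodule (regAction k A) (indAction k A N) :=
  LinearMap.codRestrict _ (TensorProduct.mk k A N).flip (fun _ _ _ => rfl)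

/-- The counit `A ⊗ Hom_{Aᵉ}(A, M) → M`, `a ⊗ f ↦ f a`, of the adjunction between
`F = A ⊗ -` and `H = Hom_{Aᵉ}(A, -)`. -/
def counitMap {M : Type*} [AddCommGroup M] [Module k M] (ρ : Env k A →ₙₐ[k] Module.End k M) :
    A ⊗[k] homSubmodule (regAction k A) ρ →ₗ[k] M :=
  TensorProduct.lift (homSubmodule (regAction k A) ρ).subtype.flip

end Algebras

/-- Taylor–Azumaya algebras: unital faithful `k`-algebras `A` for which the adjoint functors
`F = A ⊗ -` (from `k`-modules to unital left `Aᵉ`-modules) and `H = Hom_{Aᵉ}(A, -)`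
(in the other direction) are inverse equivalences, that is, the unit and the counit of the
adjunction are isomorphisms. -/
class IsTaylorAzumaya (k : Type u) [CommRing k] (A : Type v) [NonUnitalRing A] [Module k A]
    [IsScalarTower k A A] [SMulCommClass k A A] : Prop extends
    IsUnitalAlgebra k A, FaithfulSMul k A where
  unit_bijective : ∀ (N : Type (max u v)) [AddCommGroup N] [Module k N],
    Function.Bijective (unitMap k A N)
  counit_bijective : ∀ (M : Type (max u v)) [AddCommGroup M] [Module k M]
    (ρ : Env k A →ₙₐ[k] Module.End k M), IsUnitalModule ρ → Function.Bijective (counitMap k A ρ)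

/-- `A` is a `G`-module algebra: `G` acts on `A` by `k`-algebra automorphisms. -/
class IsGModuleAlgebra (k : Type*) [CommRing k] (G : Type*) [Group G] (A : Type*)
    [NonUnitalRing A] [Module k A] [DistribMulAction G A] : Prop extends
    SMulCommClass G k A where
  smul_mul : ∀ (g : G) (a b : A), g • (a * b) = (g • a) * (g • b)

/-! ### Multipliers and strongly inner actions -/

section Multipliers

variable (k : Type*) [CommRing k] (A : Type*) [NonUnitalRing A] [Module k A]

/-- Multipliers of `A`: pairs `(ρ₁, ρ₂)` with `ρ₁` right `A`-linear, `ρ₂` left `A`-linear and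
`a * ρ₁ b = ρ₂ a * b`. For `x = (ρ₁, ρ₂)` one writes `x b = ρ₁ b` and `b x = ρ₂ b`. -/
@[ext] structure Multiplier where
  left : A →ₗ[k] A
  right : A →ₗ[k] A
  left_mul : ∀ a b, left (a * b) = left a * b
  mul_right : ∀ a b, right (a * b) = a * right b
  mul_left_eq : ∀ a b, a * left b = right a * b

/-- The product `(ρ₁, ρ₂) (ρ₁', ρ₂') = (ρ₁ ∘ ρ₁', ρ₂' ∘ ρ₂)` and the unit `(id, id)`. -/
instance : Monoid (Multiplier k A) where
  mul x y :=
    { left := x.left ∘ₗ y.left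
      right := y.right ∘ₗ x.right
      left_mul := by intros; simp [x.left_mul, y.left_mul]
      mul_right := by intros; simp [x.mul_right, y.mul_right]
      mul_left_eq := by intros; simp [x.mul_left_eq, y.mul_left_eq] }
  one :=
    { left := LinearMap.id
      right := LinearMap.id
      left_mul := by intros; rfl
      mul_right := by intros; rfl
      mul_left_eq := by intros; rfl }
  mul_assoc _ _ _ := rfl
  one_mul _ := rfl
  mul_one _ := rfl

/-- The action of `G` on `A` is strongly inner: there is a group morphism `f` from `G` to the
units of the multiplier algebra of `A` such that `g • a = f(g) a f(g⁻¹)`. -/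
def IsStronglyInner (G : Type*) [Group G] [DistribMulAction G A] : Prop :=
  ∃ f : G →* (Multiplier k A)ˣ, ∀ (g : G) (a : A),
    g • a = (f g⁻¹ : Multiplier k A).right ((f g : Multiplier k A).left a)

end Multipliers

/-! ### The smash product and the graded algebra `Hom_{Aᵉ}(A, A # kG)` -/

section Smash

variable (k : Type*) [CommRing k] (A : Type*) [NonUnitalRing A] [Module k A]
  (G : Type*) [Group G] [DistribMulAction G A]

/-- The smash product `A # kG`. The element `a # g` is `SkewMonoidAlgebra.single g a`, and
`(a # g) * (b # h) = a * (g • b) # (g * h)`. -/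
abbrev Smash : Type _ := SkewMonoidAlgebra A G

variable {A G}

theorem single_mul_single (g h : G) (a b : A) :
    (SkewMonoidAlgebra.single g a * SkewMonoidAlgebra.single h b : Smash A G) =
      SkewMonoidAlgebra.single (g * h) (a * g • b) := by
  rw [SkewMonoidAlgebra.mul_def, SkewMonoidAlgebra.sum_single_index,
    SkewMonoidAlgebra.sum_single_index] <;> simp

theorem smash_mul_assoc [IsGModuleAlgebra k G A] (x y z : Smash A G) :
    x * y * z = x * (y * z) := by
  induction x using SkewMonoidAlgebra.induction_on' with
  | add x x' hx hx' => simp only [add_mul, hx, hx']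
  | single g a =>
    induction y using SkewMonoidAlgebra.induction_on' with
    | add y y' hy hy' => simp only [add_mul, mul_add, hy, hy']
    | single h b =>
      induction z using SkewMonoidAlgebra.induction_on' with
      | add z z' hz hz' => simp only [mul_add, hz, hz']
      | single l c =>
        simp only [single_mul_single, mul_assoc, mul_smul,
          IsGModuleAlgebra.smul_mul (k := k)]

theorem smash_smul_mul [IsScalarTower k A A] (r : k) (x y : Smash A G) :
    (r • x) * y = r • (x * y) := by
  induction x using SkewMonoidAlgebra.induction_on' with
  | add x x' hx hx' => simp only [smul_add, add_mul, hx, hx']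
  | single g a =>
    induction y using SkewMonoidAlgebra.induction_on' with
    | add y y' hy hy' => simp only [smul_add, mul_add, hy, hy']
    | single h b => simp only [single_mul_single, SkewMonoidAlgebra.smul_single, smul_mul_assoc]

theorem smash_mul_smul [SMulCommClass k A A] [IsGModuleAlgebra k G A] (r : k) (x y : Smash A G) :
    x * (r • y) = r • (x * y) := by
  induction x using SkewMonoidAlgebra.induction_on' with
  | add x x' hx hx' => simp only [smul_add, add_mul, hx, hx']
  | single g a =>
    induction y using SkewMonoidAlgebra.induction_on' with
    | add y y' hy hy' => simp only [smul_add, mul_add, hy, hy']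
    | single h b =>
      simp only [single_mul_single, SkewMonoidAlgebra.smul_single, mul_smul_comm, smul_comm g r b]

variable (A G)

variable [IsScalarTower k A A] [SMulCommClass k A A] [IsGModuleAlgebra k G A]

/-- Left multiplication by elements `a # 1`. -/
def smashLeft : A →ₙₐ[k] Module.End k (Smash A G) where
  toFun a :=
    { toFun := fun s => SkewMonoidAlgebra.single 1 a * s
      map_add' := by intros; rw [mul_add]
      map_smul' := by intros; simp [smash_mul_smul] }
  map_smul' r a := LinearMap.ext fun s => by
    change SkewMonoidAlgebra.single 1 (r • a) * s = r • (SkewMonoidAlgebra.single 1 a * s)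
    rw [← smash_smul_mul, SkewMonoidAlgebra.smul_single]
  map_zero' := LinearMap.ext fun s => by simp
  map_add' a b := LinearMap.ext fun s => by simp [add_mul]
  map_mul' := by
    intro a b
    refine LinearMap.ext fun s => ?_
    simp [← smash_mul_assoc k, single_mul_single]

/-- Right multiplication by elements `a # 1`. -/
def smashRight : Aᵐᵒᵖ →ₙₐ[k] Module.End k (Smash A G) where
  toFun a :=
    { toFun := fun s => s * SkewMonoidAlgebra.single 1 a.unop
      map_add' := by intros; rw [add_mul]
      map_smul' := by intros; simp [smash_smul_mul] }
  map_smul' r a := LinearMap.ext fun s => by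
    change s * SkewMonoidAlgebra.single 1 (r • a.unop) = r • (s * SkewMonoidAlgebra.single 1 a.unop)
    rw [← smash_mul_smul, SkewMonoidAlgebra.smul_single]
  map_zero' := LinearMap.ext fun s => by simp
  map_add' a b := LinearMap.ext fun s => by simp [mul_add]
  map_mul' := by
    intro a b
    refine LinearMap.ext fun s => ?_
    simp [smash_mul_assoc k, single_mul_single]

/-- `A # kG` as a left module over the enveloping algebra of `A`:
`(a ⊗ a') • s = (a # 1) * s * (a' # 1)`. -/
def smashAction : Env k A →ₙₐ[k] Module.End k (Smash A G) :=
  envAction k (smashLeft k A G) (smashRight k A G)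
    (by intro a b s; exact (smash_mul_assoc k _ _ _).symm)

theorem smashAction_single (a b : A) (a' : Aᵐᵒᵖ) (g : G) :
    smashAction k A G (a ⊗ₜ a') (SkewMonoidAlgebra.single g b) =
      SkewMonoidAlgebra.single g (a * b * g • a'.unop) := by
  change SkewMonoidAlgebra.single 1 a * SkewMonoidAlgebra.single g b *
    SkewMonoidAlgebra.single 1 a'.unop = _
  simp [single_mul_single]

/-- The `k`-module `Hom_{Aᵉ}(A, A # kG)`. -/
abbrev HomSmash : Type _ := homSubmodule (regAction k A) (smashAction k A G)

/-- The part of degree `g` of `Hom_{Aᵉ}(A, A # kG)`: the maps with values in `A # g`. -/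
def HomSmash.degree (g : G) : Submodule k (HomSmash k A G) where
  carrier := {f | ∀ a, ∃ b : A, f.1 a = SkewMonoidAlgebra.single g b}
  add_mem' := by
    intro f f' hf hf' a
    obtain ⟨b, hb⟩ := hf a
    obtain ⟨b', hb'⟩ := hf' a
    exact ⟨b + b', by simp [hb, hb']⟩
  zero_mem' := by
    intro a
    exact ⟨0, by simp⟩
  smul_mem' := by
    intro r f hf a
    obtain ⟨b, hb⟩ := hf a
    exact ⟨r • b, by simp [hb, SkewMonoidAlgebra.smul_single]⟩

variable [IsUnitalAlgebra k A]

/-- In a unital algebra, linear maps are determined by their values on products. -/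
theorem linearMap_ext_mul {N : Type*} [AddCommGroup N] [Module k N] {f f' : A →ₗ[k] N}
    (h : ∀ a b, f (a * b) = f' (a * b)) : f = f' := by
  have hs := (IsUnitalAlgebra.bijective (k := k) (A := A)).2
  refine LinearMap.ext fun a => ?_
  obtain ⟨t, rfl⟩ := hs a
  obtain ⟨t, rfl⟩ := Submodule.Quotient.mk_surjective _ t
  have hh : f ∘ₗ actionMap (NonUnitalAlgHom.lmul k A) ∘ₗ Submodule.mkQ _ =
      f' ∘ₗ actionMap (NonUnitalAlgHom.lmul k A) ∘ₗ Submodule.mkQ _ := by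
    refine TensorProduct.ext' fun a b => ?_
    exact h a b
  exact LinearMap.congr_fun hh t

variable {A G}

theorem HomSmash.map_mul_mul (f : HomSmash k A G) (a x b : A) :
    f.1 (a * x * b) = SkewMonoidAlgebra.single 1 a * f.1 x * SkewMonoidAlgebra.single 1 b :=
  f.2 (a ⊗ₜ MulOpposite.op b) x

/-- `Aᵉ`-linear maps are left `A`-linear. -/
theorem HomSmash.map_mul_left (f : HomSmash k A G) (a x : A) :
    f.1 (a * x) = SkewMonoidAlgebra.single 1 a * f.1 x := by
  have h : f.1 ∘ₗ LinearMap.mulLeft k a = smashLeft k A G a ∘ₗ f.1 := by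
    refine linearMap_ext_mul k A fun x b => ?_
    have h2 : f.1 ∘ₗ LinearMap.mulLeft k a ∘ₗ LinearMap.mulRight k b =
        smashLeft k A G a ∘ₗ f.1 ∘ₗ LinearMap.mulRight k b := by
      refine linearMap_ext_mul k A fun p q => ?_
      change f.1 (a * (p * q * b)) = SkewMonoidAlgebra.single 1 a * f.1 (p * q * b)
      rw [f.map_mul_mul, ← mul_assoc, ← mul_assoc, f.map_mul_mul]
      simp [← smash_mul_assoc k, single_mul_single]
    exact LinearMap.congr_fun h2 x
  exact LinearMap.congr_fun h x

/-- `Aᵉ`-linear maps are right `A`-linear. -/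
theorem HomSmash.map_mul_right (f : HomSmash k A G) (x b : A) :
    f.1 (x * b) = f.1 x * SkewMonoidAlgebra.single 1 b := by
  have h : f.1 ∘ₗ LinearMap.mulRight k b =
      smashRight k A G (MulOpposite.op b) ∘ₗ f.1 := by
    refine linearMap_ext_mul k A fun a x => ?_
    have h2 : f.1 ∘ₗ LinearMap.mulRight k b ∘ₗ LinearMap.mulLeft k a =
        smashRight k A G (MulOpposite.op b) ∘ₗ f.1 ∘ₗ LinearMap.mulLeft k a := by
      refine linearMap_ext_mul k A fun p q => ?_
      change f.1 (a * (p * q) * b) = f.1 (a * (p * q)) * SkewMonoidAlgebra.single 1 b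
      rw [f.map_mul_mul, f.map_mul_left k a]
    exact LinearMap.congr_fun h2 x
  exact LinearMap.congr_fun h x

/-- The map `A ⊗_A A → A # kG`, `a ⊗ b ↦ φ(a) ψ(b)`. -/
def HomSmash.prodAux (φ ψ : HomSmash k A G) :
    BalancedTensor (NonUnitalAlgHom.lmul k A) →ₗ[k] Smash A G :=
  (balancedRel _).liftQ (TensorProduct.lift (LinearMap.mk₂ k (fun a b => φ.1 a * ψ.1 b)
    (by intros; simp [add_mul]) (by intros; simp [smash_smul_mul])
    (by intros; simp [mul_add]) (by intros; simp [smash_mul_smul]))) (by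
    refine Submodule.span_le.2 ?_
    rintro _ ⟨a, b, c, rfl⟩
    simp [φ.map_mul_right k, ψ.map_mul_left k, smash_mul_assoc k])

/-- The underlying linear map of the product `φ ψ`, obtained from `a ⊗ b ↦ φ(a) ψ(b)` through the
isomorphism `A ⊗_A A ≅ A`: `(φ ψ)(∑ aᵢ aᵢ') = ∑ φ(aᵢ) ψ(aᵢ')`. -/
def HomSmash.prod (φ ψ : HomSmash k A G) : A →ₗ[k] Smash A G :=
  φ.prodAux k ψ ∘ₗ (LinearEquiv.ofBijective (actionMap (NonUnitalAlgHom.lmul k A))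
    (IsUnitalAlgebra.bijective (k := k) (A := A))).symm

theorem HomSmash.prod_mul (φ ψ : HomSmash k A G) (a b : A) :
    φ.prod k ψ (a * b) = φ.1 a * ψ.1 b := by
  have h : (LinearEquiv.ofBijective (actionMap (NonUnitalAlgHom.lmul k A))
      (IsUnitalAlgebra.bijective (k := k) (A := A))).symm (a * b) =
        Submodule.Quotient.mk (a ⊗ₜ b) := by
    rw [LinearEquiv.symm_apply_eq]
    rfl
  change φ.prodAux k ψ (LinearEquiv.symm _ (a * b)) = _
  rw [h]
  rfl

instance : Mul (HomSmash k A G) where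
  mul φ ψ := ⟨φ.prod k ψ, by
    intro z x
    have h : φ.prod k ψ ∘ₗ (regAction k A z) = smashAction k A G z ∘ₗ φ.prod k ψ := by
      refine linearMap_ext_mul k A fun x y => ?_
      induction z using TensorProduct.induction_on with
      | zero => simp
      | add z z' hz hz' =>
        simp only [LinearMap.comp_apply, map_add, LinearMap.add_apply] at hz hz' ⊢
        rw [hz, hz']
      | tmul a b =>
        change φ.prod k ψ (a * (x * y) * b.unop) =
          SkewMonoidAlgebra.single 1 a * φ.prod k ψ (x * y) * SkewMonoidAlgebra.single 1 b.unop
        rw [← mul_assoc, mul_assoc, HomSmash.prod_mul, HomSmash.prod_mul, φ.map_mul_left k,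
          ψ.map_mul_right k]
        simp only [smash_mul_assoc k]
    exact LinearMap.congr_fun h x⟩

theorem HomSmash.mul_apply_mul (φ ψ : HomSmash k A G) (a b : A) :
    (φ * ψ).1 (a * b) = φ.1 a * ψ.1 b :=
  φ.prod_mul k ψ a b

/-- The unit is the inclusion `a ↦ a # 1`. -/
instance : One (HomSmash k A G) where
  one := ⟨SkewMonoidAlgebra.lsingle k 1, by
    intro z x
    induction z using TensorProduct.induction_on with
    | zero => simp
    | add z z' hz hz' => simp only [map_add, LinearMap.add_apply, hz, hz']
    | tmul a b =>
      rw [SkewMonoidAlgebra.lsingle_apply, SkewMonoidAlgebra.lsingle_apply, smashAction_single,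
        regAction_tmul, one_smul]⟩

theorem HomSmash.one_apply (a : A) :
    (1 : HomSmash k A G).1 a = SkewMonoidAlgebra.single 1 a := rfl

theorem HomSmash.ext_mul {φ ψ : HomSmash k A G} (h : ∀ a b, φ.1 (a * b) = ψ.1 (a * b)) : φ = ψ :=
  Subtype.ext (linearMap_ext_mul k A h)

theorem HomSmash.mul_assoc' (φ ψ χ : HomSmash k A G) : φ * ψ * χ = φ * (ψ * χ) := by
  refine HomSmash.ext_mul k fun a b => ?_
  have h : (φ * ψ * χ).1 ∘ₗ LinearMap.mulLeft k a = (φ * (ψ * χ)).1 ∘ₗ LinearMap.mulLeft k a := by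
    refine linearMap_ext_mul k A fun b c => ?_
    change (φ * ψ * χ).1 (a * (b * c)) = (φ * (ψ * χ)).1 (a * (b * c))
    rw [HomSmash.mul_apply_mul k φ, HomSmash.mul_apply_mul k ψ, ← mul_assoc,
      HomSmash.mul_apply_mul k (φ * ψ), HomSmash.mul_apply_mul k φ, smash_mul_assoc k]
  exact LinearMap.congr_fun h b

/-- The ring structure of `Hom_{Aᵉ}(A, A # kG)`. -/
instance : Ring (HomSmash k A G) where
  __ := (inferInstance : AddCommGroup (HomSmash k A G))
  mul_assoc := HomSmash.mul_assoc' k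
  one_mul φ := HomSmash.ext_mul k fun a b => by
    rw [HomSmash.mul_apply_mul, HomSmash.one_apply, φ.map_mul_left k]
  mul_one φ := HomSmash.ext_mul k fun a b => by
    rw [HomSmash.mul_apply_mul, HomSmash.one_apply, φ.map_mul_right k]
  zero_mul φ := HomSmash.ext_mul k fun a b => by
    rw [HomSmash.mul_apply_mul]
    simp
  mul_zero φ := HomSmash.ext_mul k fun a b => by
    rw [HomSmash.mul_apply_mul]
    simp
  left_distrib φ ψ χ := HomSmash.ext_mul k fun a b => by
    change (φ * (ψ + χ)).1 (a * b) = (φ * ψ).1 (a * b) + (φ * χ).1 (a * b)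
    simp only [HomSmash.mul_apply_mul]
    exact mul_add _ _ _
  right_distrib φ ψ χ := HomSmash.ext_mul k fun a b => by
    change ((φ + ψ) * χ).1 (a * b) = (φ * χ).1 (a * b) + (ψ * χ).1 (a * b)
    simp only [HomSmash.mul_apply_mul]
    exact add_mul _ _ _

/-- The `k`-algebra structure of `Hom_{Aᵉ}(A, A # kG)`. -/
instance : Algebra k (HomSmash k A G) :=
  Algebra.ofModule
    (fun r φ ψ => HomSmash.ext_mul k fun a b => by
      change ((r • φ) * ψ).1 (a * b) = r • (φ * ψ).1 (a * b)
      rw [HomSmash.mul_apply_mul, HomSmash.mul_apply_mul]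
      exact smash_smul_mul k _ _ _)
    (fun r φ ψ => HomSmash.ext_mul k fun a b => by
      change (φ * (r • ψ)).1 (a * b) = r • (φ * ψ).1 (a * b)
      rw [HomSmash.mul_apply_mul, HomSmash.mul_apply_mul]
      exact smash_mul_smul k _ _ _)

end Smash

/-- The part `k g` of degree `g` of the group algebra `kG`. -/
def groupAlgebraDegree (k : Type*) [CommRing k] {G : Type*} [Group G] (g : G) :
    Submodule k (MonoidAlgebra k G) :=
  Submodule.span k {MonoidAlgebra.of k G g}

end TaylorAzumaya

end

open scoped TensorProduct

noncomputable section

namespace TaylorAzumaya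

universe u v w

/-! Both sides are compared with a third notion, `TwistedRep`. The component `A # g` of the smash
product is `A` with its right action twisted by `g`, so an `Aᵉ`-linear map `A → A # g` amounts to an
operator `R g` on `A` that is left linear and satisfies `R g (a * b) = R g a * g • b`. On products,
`R g a * g • R h b = R g (a * R h b) = R g (R h (a * b))`: the product of `Hom_{Aᵉ}(A, A # kG)`
becomes composition of operators, and a monoid map from `G` that respects degrees is a twisted
representation (`TwistedRep.ofHom`, `TwistedRep.toMonoidHom`).

If the action is strongly inner through `f`, put `R g a = a f(g⁻¹)`. Conversely, `f(g⁻¹)` is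
recovered as the multiplier with right part `R g` and left part `a ↦ R g (g⁻¹ • a)`;
`TwistedRep.multiplier_mul` is the point needing work.

It remains to see that every twisted representation yields a graded isomorphism from `kG`. The
element `∑ x_g g` goes to the map whose `g`-coefficient is `x_g R g`; as `R g` is invertible and `A`
is faithful, this is injective. For surjectivity, untwisting the `g`-coefficient of any map by `R
g⁻¹` gives a bimodule endomorphism of `A`, and `exists_finsupp_smul` turns these endomorphisms into
finitely many scalars. That lemma is the Taylor–Azumaya unit isomorphism applied to a free
`k`-module. -/

/-- Compatible left `A`-linear operators `R g` on `A`, twisted by `g` on the right. In terms of a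
strongly inner action they are the right multiplications by `f(g⁻¹)`. -/
structure TwistedRep (k : Type*) [CommRing k] (A : Type*) [NonUnitalRing A] [Module k A]
    (G : Type*) [Group G] [DistribMulAction G A] where
  R : G → A →ₗ[k] A
  one : ∀ a, R 1 a = a
  mul : ∀ g h a, R (g * h) a = R g (R h a)
  mul_left : ∀ g a b, R g (a * b) = a * R g b
  mul_right : ∀ g a b, R g (a * b) = R g a * g • b

/-! ### Invertibility of the twisted operators -/

section TwistedRep

variable {k : Type*} [CommRing k] {A : Type*} [NonUnitalRing A] [Module k A]
  {G : Type*} [Group G] [DistribMulAction G A]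

theorem TwistedRep.R_R_inv (T : TwistedRep k A G) (g : G) (a : A) :
    T.R g (T.R g⁻¹ a) = a := by
  rw [← T.mul, mul_inv_cancel, T.one]

/-- `R g` is onto, so `r` annihilates all of the faithful module `A`. -/
theorem TwistedRep.eq_zero_of_smul [FaithfulSMul k A] (T : TwistedRep k A G) {r : k} {g : G}
    (h : ∀ a, r • T.R g a = 0) : r = 0 := by
  refine FaithfulSMul.eq_of_smul_eq_smul (α := A) fun a => ?_
  rw [zero_smul, ← T.R_R_inv g a, h]

end TwistedRep

/-! ### Twisted representations and strongly inner actions -/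

section Multipliers

variable {k : Type*} [CommRing k] {A : Type*} [NonUnitalRing A] [Module k A]

theorem Multiplier.mul_left_apply (x y : Multiplier k A) (a : A) :
    (x * y).left a = x.left (y.left a) := rfl

theorem Multiplier.mul_right_apply (x y : Multiplier k A) (a : A) :
    (x * y).right a = y.right (x.right a) := rfl

theorem Multiplier.one_left_apply (a : A) : (1 : Multiplier k A).left a = a := rfl

theorem Multiplier.one_right_apply (a : A) : (1 : Multiplier k A).right a = a := rfl

variable {G : Type*} [Group G] [DistribMulAction G A]

/-- The right multiplications by `f(g⁻¹)`. -/
def TwistedRep.ofMultipliers (f : G →* (Multiplier k A)ˣ) (hf : ∀ (g : G) (a : A),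
    g • a = (f g⁻¹ : Multiplier k A).right ((f g : Multiplier k A).left a)) :
    TwistedRep k A G where
  R g := (f g⁻¹ : Multiplier k A).right
  one a := by rw [inv_one, map_one, Units.val_one, Multiplier.one_right_apply]
  mul g h a := by
    rw [mul_inv_rev, map_mul, Units.val_mul, Multiplier.mul_right_apply]
  mul_left g a b := Multiplier.mul_right _ a b
  mul_right g a b := by
    -- This is `a f(g⁻¹) · f(g) b f(g⁻¹) = a b f(g⁻¹)`.
    rw [hf, ← Multiplier.mul_right, Multiplier.mul_left_eq, ← Multiplier.mul_right_apply,
      ← Units.val_mul, ← map_mul, inv_mul_cancel, map_one, Units.val_one,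
      Multiplier.one_right_apply]

variable [IsGModuleAlgebra k G A]

/-- The multiplier `a ↦ R g (g⁻¹ • a)`, `a ↦ R g a`. -/
def TwistedRep.multiplier (T : TwistedRep k A G) (g : G) : Multiplier k A where
  left := T.R g ∘ₗ DistribSMul.toLinearMap k A g⁻¹
  right := T.R g
  left_mul a b := by
    simp [IsGModuleAlgebra.smul_mul (k := k), T.mul_right]
  mul_right := T.mul_left g
  mul_left_eq a b := by
    simp [← T.mul_left, T.mul_right]

theorem TwistedRep.multiplier_left (T : TwistedRep k A G) (g : G) (a : A) :
    (T.multiplier g).left a = T.R g (g⁻¹ • a) := rfl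

theorem TwistedRep.multiplier_one (T : TwistedRep k A G) : T.multiplier 1 = 1 := by
  refine Multiplier.ext (LinearMap.ext fun a => ?_) (LinearMap.ext fun a => T.one a)
  rw [T.multiplier_left, inv_one, one_smul, T.one, Multiplier.one_left_apply]

variable [IsScalarTower k A A] [SMulCommClass k A A] [IsUnitalAlgebra k A]

/-- The order is reversed because `T.multiplier g` plays the role of `f(g⁻¹)`. Right parts agree by
`T.mul`; for left parts no relation between `R g` and the action of `h` is given, so they are
compared on products, which suffices as `A` is unital. -/
theorem TwistedRep.multiplier_mul (T : TwistedRep k A G) (g h : G) :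
    T.multiplier (g * h) = T.multiplier h * T.multiplier g := by
  refine Multiplier.ext (linearMap_ext_mul k A fun a b => ?_) (LinearMap.ext fun a => T.mul g h a)
  rw [Multiplier.mul_left_apply, T.multiplier_left, T.multiplier_left, T.multiplier_left, T.mul]
  simp only [IsGModuleAlgebra.smul_mul (k := k)]
  rw [T.mul_right h, T.mul_left g, T.mul_right g, IsGModuleAlgebra.smul_mul (k := k),
    T.mul_right h]
  simp only [smul_smul, mul_inv_rev]
  -- With `u`, `v` the multipliers of `h`, `g`, this says `(u (x v)) y = (u x) (v y)`. Both sides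
  -- come from expanding `R h (h⁻¹ • R g (x * g⁻¹ • y))`, with `R g` moved either onto `x` or onto
  -- the second factor.
  have key : ∀ x y : A, T.R h (h⁻¹ • T.R g x) * y = T.R h (h⁻¹ • x) * T.R g (g⁻¹ • y) := by
    intro x y
    have h1 : T.R h (h⁻¹ • (T.R g (x * g⁻¹ • y))) = T.R h (h⁻¹ • T.R g x) * y := by
      rw [T.mul_right g, IsGModuleAlgebra.smul_mul (k := k), T.mul_right h]
      simp
    have h2 : T.R h (h⁻¹ • (T.R g (x * g⁻¹ • y))) = T.R h (h⁻¹ • x) * T.R g (g⁻¹ • y) := by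
      rw [T.mul_left g, IsGModuleAlgebra.smul_mul (k := k), T.mul_right h]
      simp
    rw [← h1, h2]
  have := key (g⁻¹ • a) b
  simp only [smul_smul] at this
  simp at this ⊢
  rw [this]

theorem TwistedRep.isStronglyInner (T : TwistedRep k A G) : IsStronglyInner k A G := by
  -- The inverse turns the antimultiplicative `T.multiplier` into a morphism; its values are units
  -- because `G` is a group.
  let F : G →* Multiplier k A :=
    { toFun := fun g => T.multiplier g⁻¹
      map_one' := by rw [inv_one, T.multiplier_one]
      map_mul' := fun g h => by rw [mul_inv_rev, T.multiplier_mul] }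
  refine ⟨F.toHomUnits, fun g a => ?_⟩
  change g • a = T.R (g⁻¹)⁻¹ (T.R g⁻¹ ((g⁻¹)⁻¹ • a))
  rw [← T.mul, inv_inv, mul_inv_cancel, T.one]

end Multipliers

/-! ### Bimodule endomorphisms of a Taylor–Azumaya algebra -/

section Unit

theorem mem_homSubmodule_regAction {k : Type*} [CommRing k] {A : Type*} [NonUnitalRing A]
    [Module k A] [IsScalarTower k A A] [SMulCommClass k A A] {f : A →ₗ[k] A}
    (hl : ∀ a b, f (a * b) = a * f b) (hr : ∀ a b, f (a * b) = f a * b) :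
    f ∈ homSubmodule (regAction k A) (regAction k A) := by
  intro z x
  induction z using TensorProduct.induction_on with
  | zero => simp
  | add z z' hz hz' => simp only [map_add, LinearMap.add_apply, hz, hz']
  | tmul a b => rw [regAction_tmul, regAction_tmul, hr, hl]

/-- `Aᵉ` acts only on the factor `A`, so `Aᵉ`-linearity into `A ⊗ k^(ι)` can be checked
coordinatewise. -/
theorem finsuppScalarRight_indAction {k : Type*} [CommRing k] {A : Type*} [NonUnitalRing A]
    [Module k A] [IsScalarTower k A A] [SMulCommClass k A A] {ι : Type*} [DecidableEq ι] (z : Env k A)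
    (t : A ⊗[k] (ι →₀ k)) (i : ι) :
    TensorProduct.finsuppScalarRight k k A ι (indAction k A (ι →₀ k) z t) i =
      regAction k A z (TensorProduct.finsuppScalarRight k k A ι t i) := by
  induction t using TensorProduct.induction_on with
  | zero => simp
  | add t t' ht ht' => simp only [map_add, Finsupp.add_apply, ht, ht']
  | tmul a p => simp [indAction_apply]

/-- Over a Taylor–Azumaya algebra, a pointwise finitely supported family of bimodule endomorphisms
of `A` is given by a finitely supported family of scalars. -/
theorem exists_finsupp_smul {k : Type u} [CommRing k] {A : Type v} [NonUnitalRing A] [Module k A]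
    [IsScalarTower k A A] [SMulCommClass k A A] [IsTaylorAzumaya k A] {ι : Type w}
    (ψ : ι → A →ₗ[k] A) (hψ : ∀ i, ψ i ∈ homSubmodule (regAction k A) (regAction k A))
    (hf : ∀ a, (Function.support fun i => ψ i a).Finite) :
    ∃ n : ι →₀ k, ∀ i a, ψ i a = n i • a := by
  classical
  -- The unit isomorphism is available only for modules in `Type (max u v)`, while `ι` lives in
  -- `Type w`. The indices that matter form a union over `A` of finite sets, hence a `v`-small set.
  let S : Set ι := ⋃ a, Function.support fun i => ψ i a
  have : ∀ a, Small.{v} (Function.support fun i => ψ i a) := fun a =>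
    have := (hf a).countable.to_subtype
    inferInstance
  have : Small.{v} S := small_iUnion _
  let j : Shrink.{v} S → ι := fun s => ((equivShrink S).symm s : ι)
  have hj : Function.Injective j := Subtype.val_injective.comp (equivShrink S).symm.injective
  let E := TensorProduct.finsuppScalarRight k k A (Shrink.{v} S)
  let θ : A →ₗ[k] (Shrink.{v} S →₀ A) :=
    { toFun := fun a => Finsupp.ofSupportFinite (fun s => ψ (j s) a)
        ((hf a).preimage hj.injOn)
      map_add' := fun a b => Finsupp.ext fun s => map_add (ψ (j s)) a b
      map_smul' := fun r a => Finsupp.ext fun s => map_smul (ψ (j s)) r a }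
  have hθ : E.symm.toLinearMap ∘ₗ θ ∈
      homSubmodule (regAction k A) (indAction k A (Shrink.{v} S →₀ k)) := by
    intro z a
    apply E.injective
    ext s
    rw [finsuppScalarRight_indAction]
    simp only [LinearMap.comp_apply, LinearEquiv.coe_coe]
    rw [E.apply_symm_apply, E.apply_symm_apply]
    exact hψ (j s) z a
  -- The family, read as one `Aᵉ`-linear map `A → A ⊗ k^(S)`, has the form `a ↦ a ⊗ n`; the
  -- coordinates of `n` are the scalars.
  obtain ⟨n, hn⟩ := (IsTaylorAzumaya.unit_bijective (k := k) (A := A) (Shrink.{v} S →₀ k)).2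
    ⟨_, hθ⟩
  have hn' : ∀ s a, ψ (j s) a = n s • a := by
    intro s a
    have h1 : a ⊗ₜ n = E.symm (θ a) := LinearMap.congr_fun (congrArg Subtype.val hn) a
    rw [LinearEquiv.eq_symm_apply] at h1
    have h2 := DFunLike.congr_fun h1 s
    rw [TensorProduct.finsuppScalarRight_apply_tmul_apply] at h2
    exact h2.symm
  -- Extension by zero is right, since `ψ i` vanishes identically for `i` outside `S`.
  refine ⟨n.mapDomain j, fun i a => ?_⟩
  by_cases hi : i ∈ S
  · have : j (equivShrink S ⟨i, hi⟩) = i := by simp [j]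
    rw [← this, Finsupp.mapDomain_apply hj, hn']
  · rw [Finsupp.mapDomain_of_notMem_range, zero_smul]
    · by_contra h
      exact hi (Set.mem_iUnion.2 ⟨a, h⟩)
    · rintro ⟨s, rfl⟩
      exact hi ((equivShrink S).symm s).2

end Unit

/-! ### Twisted representations and graded maps out of the group algebra -/

section Smash

/-- The coefficient of `g`, as a linear map. -/
def coeffMap (k : Type*) [CommRing k] (A : Type*) [NonUnitalRing A] [Module k A]
    {G : Type*} (g : G) : SkewMonoidAlgebra A G →ₗ[k] A where
  toFun s := s.coeff g
  map_add' := by simp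
  map_smul' := by simp

theorem coeffMap_apply {k : Type*} [CommRing k] {A : Type*} [NonUnitalRing A] [Module k A]
    {G : Type*} (g : G) (s : SkewMonoidAlgebra A G) : coeffMap k A g s = s.coeff g := rfl

variable {k : Type*} [CommRing k] {A : Type*} [NonUnitalRing A] [Module k A]
  {G : Type*} [Group G] [DistribMulAction G A]

theorem coeff_single_one_mul (a : A) (s : Smash A G) (g : G) :
    (SkewMonoidAlgebra.single 1 a * s).coeff g = a * s.coeff g := by
  classical
  induction s using SkewMonoidAlgebra.induction_on' with
  | add x y hx hy => simp [mul_add, hx, hy]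
  | single h b =>
    rw [single_mul_single, SkewMonoidAlgebra.coeff_single_apply,
      SkewMonoidAlgebra.coeff_single_apply]
    split_ifs <;> simp_all

theorem coeff_mul_single_one (a : A) (s : Smash A G) (g : G) :
    (s * SkewMonoidAlgebra.single 1 a).coeff g = s.coeff g * g • a := by
  classical
  induction s using SkewMonoidAlgebra.induction_on' with
  | add x y hx hy => simp [add_mul, hx, hy]
  | single h b =>
    rw [single_mul_single, SkewMonoidAlgebra.coeff_single_apply,
      SkewMonoidAlgebra.coeff_single_apply]
    split_ifs <;> simp_all

variable [IsScalarTower k A A] [SMulCommClass k A A] [IsGModuleAlgebra k G A]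

/-- The element `a ↦ R g a # g` of degree `g`. -/
def TwistedRep.toHomSmash (T : TwistedRep k A G) (g : G) : HomSmash k A G :=
  ⟨SkewMonoidAlgebra.lsingle k g ∘ₗ T.R g, by
    intro z x
    induction z using TensorProduct.induction_on with
    | zero => simp
    | add z z' hz hz' => simp only [map_add, LinearMap.add_apply, hz, hz']
    | tmul a b =>
      simp only [LinearMap.comp_apply, SkewMonoidAlgebra.lsingle_apply]
      rw [smashAction_single, regAction_tmul, T.mul_right, T.mul_left]⟩

theorem TwistedRep.toHomSmash_apply (T : TwistedRep k A G) (g : G) (a : A) :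
    (T.toHomSmash g).1 a = SkewMonoidAlgebra.single g (T.R g a) := rfl

theorem coeff_eq_zero_of_mem_degree {g h : G} (hgh : h ≠ g) {φ : HomSmash k A G}
    (hφ : φ ∈ HomSmash.degree k A G g) (a : A) : (φ.1 a).coeff h = 0 := by
  classical
  obtain ⟨b, hb⟩ := hφ a
  rw [hb, SkewMonoidAlgebra.coeff_single_apply, if_neg hgh.symm]

theorem apply_eq_single_of_mem_degree {g : G} {φ : HomSmash k A G}
    (hφ : φ ∈ HomSmash.degree k A G g) (a : A) :
    φ.1 a = SkewMonoidAlgebra.single g ((φ.1 a).coeff g) := by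
  obtain ⟨b, hb⟩ := hφ a
  rw [hb]
  simp

variable [IsUnitalAlgebra k A]

/-- A graded algebra map `kG → Hom(A, A # kG)` gives a twisted representation. -/
def TwistedRep.ofHom (φ : G →* HomSmash k A G)
    (hφ : ∀ g, φ g ∈ HomSmash.degree k A G g) : TwistedRep k A G where
  R g := coeffMap k A g ∘ₗ (φ g).1
  one a := by
    rw [map_one, LinearMap.comp_apply, HomSmash.one_apply, coeffMap_apply]
    simp
  mul g h := by
    suffices H : coeffMap k A (g * h) ∘ₗ (φ (g * h)).1 =
        (coeffMap k A g ∘ₗ (φ g).1) ∘ₗ (coeffMap k A h ∘ₗ (φ h).1) from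
      fun a => LinearMap.congr_fun H a
    refine linearMap_ext_mul k A fun a b => ?_
    simp only [LinearMap.comp_apply, coeffMap_apply]
    -- Both sides at `a * b` reduce to `R g a * g • R h b`.
    rw [map_mul φ, HomSmash.mul_apply_mul, HomSmash.map_mul_left, coeff_single_one_mul,
      HomSmash.map_mul_right, coeff_mul_single_one, apply_eq_single_of_mem_degree (hφ g),
      apply_eq_single_of_mem_degree (hφ h), single_mul_single]
    simp
  mul_left g a b := by
    simp only [LinearMap.comp_apply, coeffMap_apply]
    rw [HomSmash.map_mul_left, coeff_single_one_mul]
  mul_right g a b := by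
    simp only [LinearMap.comp_apply, coeffMap_apply]
    rw [HomSmash.map_mul_right, coeff_mul_single_one]

/-- The monoid morphism `g ↦ (a ↦ R g a # g)`. -/
def TwistedRep.toMonoidHom (T : TwistedRep k A G) : G →* HomSmash k A G where
  toFun := T.toHomSmash
  map_one' := Subtype.ext <| LinearMap.ext fun a => by
    rw [T.toHomSmash_apply, T.one, HomSmash.one_apply]
  map_mul' g h := HomSmash.ext_mul k fun a b => by
    rw [HomSmash.mul_apply_mul, T.toHomSmash_apply, T.toHomSmash_apply, T.toHomSmash_apply,
      single_mul_single, ← T.mul_right, ← T.mul_left, T.mul]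

theorem TwistedRep.coeff_lift (T : TwistedRep k A G) (x : MonoidAlgebra k G) (a : A) (g : G) :
    ((MonoidAlgebra.lift k (HomSmash k A G) G T.toMonoidHom x).1 a).coeff g =
      x.coeff g • T.R g a := by
  classical
  let ev : HomSmash k A G →ₗ[k] A :=
    coeffMap k A g ∘ₗ LinearMap.applyₗ a ∘ₗ Submodule.subtype _
  change ev _ = _
  rw [MonoidAlgebra.lift_apply, map_finsuppSum, Finsupp.sum_eq_single g]
  · rw [map_smul]
    change _ • (SkewMonoidAlgebra.single g (T.R g a)).coeff g = _
    simp
  · intro h _ hne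
    rw [map_smul]
    change _ • (SkewMonoidAlgebra.single h (T.R h a)).coeff g = _
    rw [SkewMonoidAlgebra.coeff_single_apply, if_neg hne, smul_zero]
  · simp

theorem TwistedRep.lift_injective [FaithfulSMul k A] (T : TwistedRep k A G) :
    Function.Injective (MonoidAlgebra.lift k (HomSmash k A G) G T.toMonoidHom) := by
  rw [injective_iff_map_eq_zero]
  intro x hx
  refine MonoidAlgebra.ext (Finsupp.ext fun g => T.eq_zero_of_smul (g := g) fun a => ?_)
  rw [← T.coeff_lift, hx]
  rfl

end Smash

/-! ### The graded isomorphism attached to a twisted representation -/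

section Graded

variable {k : Type*} [CommRing k] {A : Type*} [NonUnitalRing A] [Module k A]
  [IsScalarTower k A A] [SMulCommClass k A A] {G : Type*} [Group G] [DistribMulAction G A]
  [IsTaylorAzumaya k A] [IsGModuleAlgebra k G A]

theorem TwistedRep.lift_surjective (T : TwistedRep k A G) :
    Function.Surjective (MonoidAlgebra.lift k (HomSmash k A G) G T.toMonoidHom) := by
  intro φ
  -- The `g`-coefficient of `φ` is right linear up to the twist by `g`; composing with `R g⁻¹`
  -- cancels the twist and leaves a bimodule endomorphism, hence a scalar `n g`.
  obtain ⟨n, hn⟩ := exists_finsupp_smul (k := k) (A := A)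
    (fun g : G => T.R g⁻¹ ∘ₗ coeffMap k A g ∘ₗ φ.1)
    (fun g => mem_homSubmodule_regAction
      (fun a b => by
        simp only [LinearMap.comp_apply, coeffMap_apply]
        rw [HomSmash.map_mul_left, coeff_single_one_mul, T.mul_left])
      (fun a b => by
        simp only [LinearMap.comp_apply, coeffMap_apply]
        rw [HomSmash.map_mul_right, coeff_mul_single_one, T.mul_right, inv_smul_smul]))
    (fun a => (φ.1 a).coeff.hasFiniteSupport.subset fun g hg h => hg (by
      change T.R g⁻¹ ((φ.1 a).coeff g) = 0
      rw [h, map_zero]))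
  refine ⟨MonoidAlgebra.ofCoeff n, Subtype.ext <| LinearMap.ext fun a =>
    SkewMonoidAlgebra.ext fun g => ?_⟩
  rw [T.coeff_lift, MonoidAlgebra.coeff_ofCoeff, ← map_smul, ← hn]
  exact T.R_R_inv g _

theorem TwistedRep.map_groupAlgebraDegree (T : TwistedRep k A G) (g : G) :
    (groupAlgebraDegree k g).map
      (MonoidAlgebra.lift k (HomSmash k A G) G T.toMonoidHom).toLinearMap =
        HomSmash.degree k A G g := by
  apply le_antisymm
  · rw [groupAlgebraDegree, Submodule.map_span_le]
    rintro _ rfl a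
    refine ⟨T.R g a, ?_⟩
    rw [AlgHom.toLinearMap_apply, MonoidAlgebra.lift_of]
    rfl
  · intro φ hφ
    -- For `h ≠ g` the `h`-coefficient `x_h R h` of the image vanishes, so faithfulness forces `x_h
    -- = 0` and `x` is a multiple of `g`.
    obtain ⟨x, rfl⟩ := T.lift_surjective φ
    refine Submodule.mem_map_of_mem ?_
    rw [groupAlgebraDegree, Submodule.mem_span_singleton]
    refine ⟨x.coeff g, MonoidAlgebra.ext (Finsupp.ext fun h => ?_)⟩
    by_cases hgh : h = g
    · subst hgh
      simp
    · have : x.coeff h = 0 := T.eq_zero_of_smul (g := h) fun a => by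
        rw [← T.coeff_lift, coeff_eq_zero_of_mem_degree hgh hφ]
      simp [this, Finsupp.single_eq_of_ne hgh]

end Graded

end TaylorAzumaya

end

theorem lemma3p6 {k : Type*} [CommRing k] {A : Type*} [NonUnitalRing A] [Module k A]
    [IsScalarTower k A A] [SMulCommClass k A A] {G : Type*} [Group G] [DistribMulAction G A]
    [TaylorAzumaya.IsTaylorAzumaya k A] [TaylorAzumaya.IsGModuleAlgebra k G A] :
    TaylorAzumaya.IsStronglyInner k A G ↔
      ∃ e : MonoidAlgebra k G ≃ₐ[k] TaylorAzumaya.HomSmash k A G,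
        ∀ g : G, (TaylorAzumaya.groupAlgebraDegree k g).map e.toLinearMap =
          TaylorAzumaya.HomSmash.degree k A G g := by
  constructor
  · rintro ⟨f, hf⟩
    let T := TaylorAzumaya.TwistedRep.ofMultipliers f hf
    exact ⟨AlgEquiv.ofBijective _ ⟨T.lift_injective, T.lift_surjective⟩,
      T.map_groupAlgebraDegree⟩
  · rintro ⟨e, he⟩
    -- Only the restriction of `e` to group elements enters: it is multiplicative and sends `g` into
    -- degree `g`.
    refine (TaylorAzumaya.TwistedRep.ofHom ((e : MonoidAlgebra k G →*
      TaylorAzumaya.HomSmash k A G).comp (MonoidAlgebra.of k G)) fun g => ?_).isStronglyInner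
    rw [← he g]
    exact Submodule.mem_map_of_mem (Submodule.subset_span rfl)
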